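/- All graphs are finite, undirected and without loops or multiple edges. For a connected graph $\Gamma=(X,E)$, a vertex $x\in X$ and $i\ge 0$, let $\Gamma_i(x)$ be the set of vertices at distance $i$ from $x$; for $y\in\Gamma_i(x)$ put $$c_i(x,y)=|\Gamma_{i-1}(x)\cap\Gamma_1(y)|,\qquad a_i(x,y)=|\Gamma_i(x)\cap\Gamma_1(y)|,\qquad b_i(x,y)=|\Gamma_{i+1}(x)\cap\Gamma_1(y)|,$$ with $c_0(x,y)=0$. The graph $\Gamma$ is distance-regularized if it is connected and for every $x$ and $i$ these three numbers do not depend on the choice of $y\in\Gamma_i(x)$; they are then denoted by $c_i(x),a_i(x),b_i(x)$, and the array of the triples $(c_i(x),a_i(x),b_i(x))$, where $i$ runs from $0$ to the largest distance from $x$ to a vertex, is the intersection array of $x$. A distance-biregular graph is a bipartite distance-regularized graph in which all vertices in the same class of the bipartition have the same intersection array. Two graphs are cospectral if their adjacency matrices have the same multiset of eigenvalues, counted with multiplicity. They are $C^3$-equivalent if they satisfy exactly the same sentences of $C^3$, the fragment with only three distinct variables of first-order logic in the language of graphs (adjacency and equality) extended by the counting quantifiers $\exists^{\ge i}$ ("there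 are at least $i$ distinct vertices such that"), $i\ge 1$. **Theorem.** Two distance-biregular graphs $\Gamma$ and $\Delta$ are cospectral if and only if they are $C^3$-equivalent. -/

import Mathlib

namespace SimpleGraph

variable {V : Type*}

/-! ### Distance-biregular graphs -/

/-- The set `Γ_i(x)` of vertices at distance `i` from `x` (for a connected graph). -/
def distSphere (G : SimpleGraph V) (x : V) (i : ℕ) : Set V :=
  {y | G.dist x y = i}

/-- `c_i(x,y) = |Γ_{i-1}(x) ∩ Γ_1(y)|` where `i = d(x,y)`, with `c_0(x,y) = 0`. -/
noncomputable def cNum (G : SimpleGraph V) (x y : V) : ℕ :=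
  if G.dist x y = 0 then 0
  else (G.distSphere x (G.dist x y - 1) ∩ G.distSphere y 1).ncard

/-- `a_i(x,y) = |Γ_i(x) ∩ Γ_1(y)|` where `i = d(x,y)`. -/
noncomputable def aNum (G : SimpleGraph V) (x y : V) : ℕ :=
  (G.distSphere x (G.dist x y) ∩ G.distSphere y 1).ncard

/-- `b_i(x,y) = |Γ_{i+1}(x) ∩ Γ_1(y)|` where `i = d(x,y)`. -/
noncomputable def bNum (G : SimpleGraph V) (x y : V) : ℕ :=
  (G.distSphere x (G.dist x y + 1) ∩ G.distSphere y 1).ncard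

/-- The vertex `x` is distance-regularized: `c_i(x,y)`, `a_i(x,y)`, `b_i(x,y)` do not depend on
the choice of `y` in `Γ_i(x)`. -/
def IsDistanceRegularizedAt (G : SimpleGraph V) (x : V) : Prop :=
  ∀ i : ℕ, ∀ y ∈ G.distSphere x i, ∀ z ∈ G.distSphere x i,
    G.cNum x y = G.cNum x z ∧ G.aNum x y = G.aNum x z ∧ G.bNum x y = G.bNum x z

/-- A distance-regularized graph: connected, and every vertex is distance-regularized. -/
def IsDistanceRegularized (G : SimpleGraph V) : Prop :=
  G.Connected ∧ ∀ x, G.IsDistanceRegularizedAt x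

/-- The intersection array of the vertex `x`, as the set of its columns, each labelled by its
index `i`: the set of all `(i, c_i(x,y), a_i(x,y), b_i(x,y))` with `y` in `Γ_i(x)`. If `x` is
distance-regularized, this is the graph of the function `i ↦ (c_i(x), a_i(x), b_i(x))` on
`{0, …, e}`, where `e` is the largest distance from `x`. -/
def intersectionArray (G : SimpleGraph V) (x : V) : Set (ℕ × ℕ × ℕ × ℕ) :=
  {t | ∃ i : ℕ, ∃ y ∈ G.distSphere x i, t = (i, G.cNum x y, G.aNum x y, G.bNum x y)}

/-- A distance-biregular graph: a distance-regularized graph that is bipartite, with bipartition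
`(X', X'')` say, such that all vertices in the same class have the same intersection array. -/
def IsDistanceBiregular (G : SimpleGraph V) : Prop :=
  G.IsDistanceRegularized ∧
    ∃ X' X'' : Set V, X' ∪ X'' = Set.univ ∧ G.IsBipartiteWith X' X'' ∧
      (∀ x ∈ X', ∀ y ∈ X', G.intersectionArray x = G.intersectionArray y) ∧
      (∀ x ∈ X'', ∀ y ∈ X'', G.intersectionArray x = G.intersectionArray y)

/-! ### Spectra -/

open Classical in
/-- The spectrum of a finite graph: the multiset of the eigenvalues of its real adjacency matrix,
counted with multiplicity. (The matrix is symmetric, so all its eigenvalues are real.) -/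
noncomputable def adjSpectrum [Fintype V] (G : SimpleGraph V) : Multiset ℝ :=
  (G.adjMatrix ℝ).charpoly.roots

/-- Two finite graphs are cospectral if they have the same spectrum. -/
def Cospectral {V W : Type*} [Fintype V] [Fintype W] (G : SimpleGraph V) (H : SimpleGraph W) :
    Prop :=
  G.adjSpectrum = H.adjSpectrum

/-! ### First-order logic with counting quantifiers and `k` variables -/

/-- Formulas of `C^k` in the language of graphs; the variables are the elements of `Fin k`. -/
inductive CFormula (k : ℕ) : Type
  | eq (i j : Fin k) : CFormula k
  | adj (i j : Fin k) : CFormula k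
  | not (φ : CFormula k) : CFormula k
  | and (φ ψ : CFormula k) : CFormula k
  | or (φ ψ : CFormula k) : CFormula k
  | imp (φ ψ : CFormula k) : CFormula k
  | iff (φ ψ : CFormula k) : CFormula k
  | ex (i : Fin k) (φ : CFormula k) : CFormula k
  | all (i : Fin k) (φ : CFormula k) : CFormula k
  | exGe (n : ℕ+) (i : Fin k) (φ : CFormula k) : CFormula k

namespace CFormula

variable {k : ℕ}

/-- The set of variables that occur free in a formula. -/
def freeVars : CFormula k → Finset (Fin k)
  | eq i j => {i, j}
  | adj i j => {i, j}
  | not φ => φ.freeVars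
  | and φ ψ => φ.freeVars ∪ ψ.freeVars
  | or φ ψ => φ.freeVars ∪ ψ.freeVars
  | imp φ ψ => φ.freeVars ∪ ψ.freeVars
  | iff φ ψ => φ.freeVars ∪ ψ.freeVars
  | ex i φ => φ.freeVars.erase i
  | all i φ => φ.freeVars.erase i
  | exGe _ i φ => φ.freeVars.erase i

/-- A sentence is a formula without free variables. -/
def IsSentence (φ : CFormula k) : Prop :=
  φ.freeVars = ∅

/-- Truth of a formula in the graph `G` under the assignment `v` of vertices to the variables.
`exGe n i φ` says that at least `n` distinct vertices can be substituted for the variable `i`. -/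
def Realize (G : SimpleGraph V) : CFormula k → (Fin k → V) → Prop
  | eq i j, v => v i = v j
  | adj i j, v => G.Adj (v i) (v j)
  | not φ, v => ¬ φ.Realize G v
  | and φ ψ, v => φ.Realize G v ∧ ψ.Realize G v
  | or φ ψ, v => φ.Realize G v ∨ ψ.Realize G v
  | imp φ ψ, v => φ.Realize G v → ψ.Realize G v
  | iff φ ψ, v => φ.Realize G v ↔ ψ.Realize G v
  | ex i φ, v => ∃ x : V, φ.Realize G (Function.update v i x)
  | all i φ, v => ∀ x : V, φ.Realize G (Function.update v i x)
  | exGe n i φ, v =>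
      ∃ s : Finset V, s.card = (n : ℕ) ∧ ∀ x ∈ s, φ.Realize G (Function.update v i x)

end CFormula

/-- `G ⊨ φ`, for a sentence `φ` and a graph `G` with at least one vertex: `φ` is true in `G`
(under every assignment; the truth of a sentence does not depend on the assignment). -/
def Satisfies (G : SimpleGraph V) {k : ℕ} (φ : CFormula k) : Prop :=
  ∀ v : Fin k → V, φ.Realize G v

/-- Two graphs are `C^k`-equivalent if they satisfy exactly the same sentences of `C^k`. -/
def CEquiv (k : ℕ) {V W : Type*} (G : SimpleGraph V) (H : SimpleGraph W) : Prop :=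
  ∀ φ : CFormula k, φ.IsSentence → (G.Satisfies φ ↔ H.Satisfies φ)

end SimpleGraph

/-! For $C^3$-equivalence ⇒ cospectrality, finite nonempty graphs suffice. Counting quantifiers turn
equality of types into a bijection for the next pebble (`SameType.exists_equiv`). Two pebbles on the
ends of a walk and a third on its next vertex show that types determine walk numbers, hence all
traces of $A^m$. These are the power sums of the eigenvalues and determine the spectrum.

Conversely, the spectrum determines both intersection arrays up to exchanging the classes. Let $k,l$
be the two valencies. $A^2$ has constant row sum $kl$, so trace growth gives $kl$; the numbers of
vertices and edges then give $k+l$ (`HasArrays.valency_eq_or`). Since closed walks of positive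
length start equally often in either class, the number of them at a vertex of each class is known,
and yields $c_{i+1}$ from the earlier entries (`eq_of_walkCount_eq`); $b_{i+1}$ follows from $c+b$
being a valency.

Finally, the arrays determine how many vertices have given distances from two given vertices
(`HasArrays.sum_ite_dist_eq_pairCount`). So the bijective 3-pebble game can be played preserving
colours and distances (`HasArrays.realize_iff`). -/

namespace SimpleGraph

/-! ### Types in $C^3$ and walk counts -/

section Logic

open Function

variable {V W : Type*} {G : SimpleGraph V} {H : SimpleGraph W}

theorem CFormula.realize_congr {k : ℕ} (φ : CFormula k) : ∀ {v w : Fin k → V},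
    (∀ i ∈ φ.freeVars, v i = w i) → (φ.Realize G v ↔ φ.Realize G w) := by
  have key : ∀ {S : Finset (Fin k)} {v w : Fin k → V} {i : Fin k} (x : V),
      (∀ j ∈ S.erase i, v j = w j) → ∀ j ∈ S, update v i x j = update w i x j := by
    intro S v w i x h j hj
    by_cases hji : j = i
    · subst hji; simp
    · simpa [hji] using h j (Finset.mem_erase.2 ⟨hji, hj⟩)
  induction φ with
  | eq i j | adj i j =>
    intro v w h
    simp only [freeVars, Finset.mem_insert, Finset.mem_singleton] at h
    simp [Realize, h i, h j]
  | not φ ih => intro v w h; exact not_congr (ih h)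
  | and φ ψ ih₁ ih₂ =>
    intro v w h
    simp only [freeVars, Finset.mem_union] at h
    exact and_congr (ih₁ fun i hi => h i (.inl hi)) (ih₂ fun i hi => h i (.inr hi))
  | or φ ψ ih₁ ih₂ =>
    intro v w h
    simp only [freeVars, Finset.mem_union] at h
    exact or_congr (ih₁ fun i hi => h i (.inl hi)) (ih₂ fun i hi => h i (.inr hi))
  | imp φ ψ ih₁ ih₂ =>
    intro v w h
    simp only [freeVars, Finset.mem_union] at h
    exact imp_congr (ih₁ fun i hi => h i (.inl hi)) (ih₂ fun i hi => h i (.inr hi))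
  | iff φ ψ ih₁ ih₂ =>
    intro v w h
    simp only [freeVars, Finset.mem_union] at h
    exact iff_congr (ih₁ fun i hi => h i (.inl hi)) (ih₂ fun i hi => h i (.inr hi))
  | ex i φ ih => intro v w h; exact exists_congr fun x => ih (key x h)
  | all i φ ih => intro v w h; exact forall_congr' fun x => ih (key x h)
  | exGe n i φ ih =>
    intro v w h
    exact exists_congr fun s => and_congr_right fun _ => forall₂_congr fun x _ => ih (key x h)

theorem CFormula.IsSentence.satisfies_iff {k : ℕ} {φ : CFormula k} (hφ : φ.IsSentence)
    (v : Fin k → V) : G.Satisfies φ ↔ φ.Realize G v := by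
  refine ⟨fun h => h v, fun h w => (φ.realize_congr fun i hi => ?_).1 h⟩
  rw [hφ] at hi
  simp at hi

/-- The assignments `v` and `w` satisfy the same formulas of `C^k`. -/
def SameType {k : ℕ} (G : SimpleGraph V) (H : SimpleGraph W) (v : Fin k → V) (w : Fin k → W) :
    Prop :=
  ∀ φ : CFormula k, φ.Realize G v ↔ φ.Realize H w

theorem SameType.symm {k : ℕ} {v : Fin k → V} {w : Fin k → W} (h : SameType G H v w) :
    SameType H G w v :=
  fun φ => (h φ).symm

/-- There are finitely many assignments into `W`; conjoin one separating formula for each that has a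
different type, negated where necessary. -/
theorem exists_isolating_formula [Finite W] (G : SimpleGraph V) (H : SimpleGraph W)
    (v : Fin 3 → V) :
    ∃ φ : CFormula 3, φ.Realize G v ∧ ∀ w, φ.Realize H w → SameType G H v w := by
  classical
  have := Fintype.ofFinite W
  suffices h : ∀ s : Finset (Fin 3 → W), ∃ φ : CFormula 3, φ.Realize G v ∧
      ∀ w ∈ s, φ.Realize H w → SameType G H v w by
    simpa using h Finset.univ
  intro s
  induction s using Finset.induction_on with
  | empty => exact ⟨.eq 0 0, rfl, by simp⟩
  | insert w s _ ih =>
    obtain ⟨φ, hφ, hs⟩ := ih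
    obtain ⟨ψ, hψ, hw⟩ : ∃ ψ : CFormula 3, ψ.Realize G v ∧
        (ψ.Realize H w → SameType G H v w) := by
      by_cases h : SameType G H v w
      · exact ⟨.eq 0 0, rfl, fun _ => h⟩
      · obtain ⟨ψ, hψ⟩ := not_forall.1 h
        by_cases hv : ψ.Realize G v
        · exact ⟨ψ, hv, fun h => absurd (iff_of_true hv h) hψ⟩
        · exact ⟨.not ψ, hv, fun h => absurd (iff_of_false hv h) hψ⟩
    refine ⟨.and φ ψ, ⟨hφ, hψ⟩, fun u hu h => ?_⟩
    rcases Finset.mem_insert.1 hu with rfl | hu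
    · exact hw h.2
    · exact hs u hu h.1

theorem exists_equiv_of_card_fiber_eq {T : Type*} [Finite V] [Finite W] {f : V → T} {g : W → T}
    (h : ∀ t, Nat.card {x // f x = t} = Nat.card {y // g y = t}) :
    ∃ σ : V ≃ W, ∀ x, g (σ x) = f x :=
  ⟨Equiv.ofFiberEquiv fun t => (Finite.card_eq.1 (h t)).some,
    fun x => Equiv.ofFiberEquiv_map _ x⟩

theorem SameType.card_fiber_le [Finite V] [Finite W] {v : Fin 3 → V} {w : Fin 3 → W}
    (h : SameType G H v w) (i : Fin 3) (T : Set (CFormula 3)) :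
    Nat.card {x // {φ : CFormula 3 | φ.Realize G (update v i x)} = T} ≤
      Nat.card {y // {φ : CFormula 3 | φ.Realize H (update w i y)} = T} := by
  classical
  have := Fintype.ofFinite V
  have := Fintype.ofFinite W
  rw [Nat.card_eq_fintype_card, Nat.card_eq_fintype_card, Fintype.card_subtype,
    Fintype.card_subtype]
  set s := Finset.univ.filter fun x => {φ : CFormula 3 | φ.Realize G (update v i x)} = T with hs
  -- The quantifier `exGe` needs a positive bound, and the isolating formula needs a vertex
  -- realizing `T`.
  rcases s.eq_empty_or_nonempty with h0 | ⟨x₀, hx₀⟩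
  · simp [h0]
  obtain ⟨φ, hφ, hiso⟩ := exists_isolating_formula G H (update v i x₀)
  have hx₀T : {φ : CFormula 3 | φ.Realize G (update v i x₀)} = T := by simpa [hs] using hx₀
  have hpos : 0 < s.card := Finset.card_pos.2 ⟨x₀, hx₀⟩
  have hG : (CFormula.exGe ⟨s.card, hpos⟩ i φ).Realize G v := by
    refine ⟨s, rfl, fun x hx => ?_⟩
    have hxT : {φ : CFormula 3 | φ.Realize G (update v i x)} = T := by simpa [hs] using hx
    have : φ ∈ {φ : CFormula 3 | φ.Realize G (update v i x)} := by
      rw [hxT, ← hx₀T]; exact hφ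
    exact this
  obtain ⟨r, hr, hrφ⟩ := (h _).1 hG
  change r.card = s.card at hr
  rw [← hr]
  refine Finset.card_le_card fun y hy => ?_
  simp only [Finset.mem_filter, Finset.mem_univ, true_and]
  rw [← hx₀T]
  ext ψ
  exact (hiso _ (hrφ y hy) ψ).symm

theorem SameType.exists_equiv [Finite V] [Finite W] {v : Fin 3 → V} {w : Fin 3 → W}
    (h : SameType G H v w) (i : Fin 3) :
    ∃ σ : V ≃ W, ∀ x, SameType G H (update v i x) (update w i (σ x)) := by
  obtain ⟨σ, hσ⟩ := exists_equiv_of_card_fiber_eq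
    fun T => le_antisymm (h.card_fiber_le i T) (h.symm.card_fiber_le i T)
  exact ⟨σ, fun x φ => (Set.ext_iff.1 (hσ x) φ).symm⟩

theorem CEquiv.exists_sameType [Nonempty V] [Nonempty W] [Finite W] (h : CEquiv 3 G H) :
    ∃ (v : Fin 3 → V) (w : Fin 3 → W), SameType G H v w := by
  obtain ⟨x₀⟩ := ‹Nonempty V›
  obtain ⟨y₀⟩ := ‹Nonempty W›
  obtain ⟨φ, hφ, hiso⟩ := exists_isolating_formula G H fun _ => x₀
  have hsent : (CFormula.ex 0 (.ex 1 (.ex 2 φ))).IsSentence := by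
    ext i
    fin_cases i <;> simp [CFormula.freeVars]
  have hG : (CFormula.ex 0 (.ex 1 (.ex 2 φ))).Realize G fun _ => x₀ := by
    refine ⟨x₀, x₀, x₀, ?_⟩
    convert hφ using 1
    funext j
    simp [update_apply]
  obtain ⟨x, y, z, hH⟩ := (hsent.satisfies_iff fun _ => y₀).1
    ((h _ hsent).1 ((hsent.satisfies_iff _).2 hG))
  exact ⟨_, _, hiso _ hH⟩

open Classical in
theorem SameType.adjMatrix_pow_apply [Fintype V] [Fintype W] (m : ℕ) :
    ∀ {v : Fin 3 → V} {w : Fin 3 → W}, SameType G H v w → ∀ i j,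
      (G.adjMatrix ℝ ^ m) (v i) (v j) = (H.adjMatrix ℝ ^ m) (w i) (w j) := by
  induction m with
  | zero =>
    intro v w h i j
    have := h (.eq i j)
    simp only [CFormula.Realize] at this
    simp [Matrix.one_apply, this]
  | succ m ih =>
    intro v w h i j
    -- The free third variable runs over the second vertex of the walk; this is where three
    -- variables are needed.
    obtain ⟨k, hki, hkj⟩ : ∃ k : Fin 3, i ≠ k ∧ j ≠ k := by decide +revert
    obtain ⟨σ, hσ⟩ := h.exists_equiv k
    rw [pow_succ', pow_succ', Matrix.mul_apply, Matrix.mul_apply]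
    refine Fintype.sum_equiv σ _ _ fun z => ?_
    have h1 := hσ z (.adj i k)
    have h2 := ih (hσ z) k j
    simp only [CFormula.Realize, update_self, update_of_ne hki] at h1
    simp only [update_self, update_of_ne hkj] at h2
    simp [adjMatrix_apply, h1, h2]

open Classical in
theorem CEquiv.trace_adjMatrix_pow [Nonempty V] [Nonempty W] [Fintype V] [Fintype W]
    (h : CEquiv 3 G H) (m : ℕ) :
    (G.adjMatrix ℝ ^ m).trace = (H.adjMatrix ℝ ^ m).trace := by
  obtain ⟨v, w, hvw⟩ := h.exists_sameType
  obtain ⟨σ, hσ⟩ := hvw.exists_equiv 0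
  refine Fintype.sum_equiv σ _ _ fun z => ?_
  simpa using (hσ z).adjMatrix_pow_apply m 0 0

end Logic

/-! ### Power sums determine the spectrum -/

section Spectrum

theorem _root_.Multiset.eq_of_sum_map_pow_eq {K : Type*} [Field K] [CharZero K] {s t : Multiset K}
    (h : ∀ m : ℕ, (s.map (· ^ m)).sum = (t.map (· ^ m)).sum) : s = t := by
  classical
  have hp : ∀ p : Polynomial K, (s.map p.eval).sum = (t.map p.eval).sum := by
    intro p
    induction p using Polynomial.induction_on' with
    | add p q hp hq =>
      simp only [Polynomial.eval_add, Multiset.sum_map_add, hp, hq]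
    | monomial n a =>
      simp only [Polynomial.eval_monomial, Multiset.sum_map_mul_left, h]
  ext a
  -- The polynomial is 1 at `a` and 0 at all other elements of `s` and `t`, so summing it over
  -- either multiset counts `a`.
  set p : Polynomial K :=
    Lagrange.interpolate (insert a (s + t).toFinset) id (Pi.single a 1) with hpdef
  have heval : ∀ b ∈ insert a (s + t).toFinset, p.eval b = if a = b then 1 else 0 := by
    intro b hb
    have := Lagrange.eval_interpolate_at_node (v := id) (Pi.single a (1 : K))
      (Set.injOn_id _) hb
    rw [id] at this
    rw [hpdef, this]
    simp [Pi.single_apply, eq_comm]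
  have hcount : ∀ u : Multiset K, u ≤ s + t → (u.map p.eval).sum = u.count a := by
    intro u hu
    rw [Multiset.map_congr rfl fun b hb => heval b
      (Finset.mem_insert_of_mem (Multiset.mem_toFinset.2 (Multiset.mem_of_le hu hb)))]
    clear hu
    induction u using Multiset.induction_on with
    | empty => simp
    | cons b u ih => simp [ih, Multiset.count_cons, add_comm]
  have := hp p
  rw [hcount s (Multiset.le_add_right s t), hcount t (Multiset.le_add_left t s)] at this
  exact_mod_cast this

theorem _root_.Matrix.IsHermitian.trace_pow_eq_sum_roots {n : Type*} [Fintype n] [DecidableEq n]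
    {A : Matrix n n ℝ} (hA : A.IsHermitian) (m : ℕ) :
    (A ^ m).trace = (A.charpoly.roots.map (· ^ m)).sum := by
  rw [hA.roots_charpoly_eq_eigenvalues, Multiset.map_map]
  conv_lhs => rw [hA.spectral_theorem, ← map_pow, Unitary.conjStarAlgAut_apply,
    Matrix.trace_mul_cycle, Unitary.coe_star_mul_self, one_mul, Matrix.diagonal_pow,
    Matrix.trace_diagonal]
  rfl

variable {V W : Type*} [Fintype V] [Fintype W] {G : SimpleGraph V} {H : SimpleGraph W}

open Classical in
theorem cospectral_iff_trace_adjMatrix_pow :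
    G.Cospectral H ↔ ∀ m : ℕ, (G.adjMatrix ℝ ^ m).trace = (H.adjMatrix ℝ ^ m).trace := by
  have hG : (G.adjMatrix ℝ).IsHermitian := by
    rw [Matrix.IsHermitian, Matrix.conjTranspose_eq_transpose_of_trivial, transpose_adjMatrix]
  have hH : (H.adjMatrix ℝ).IsHermitian := by
    rw [Matrix.IsHermitian, Matrix.conjTranspose_eq_transpose_of_trivial, transpose_adjMatrix]
  simp only [hG.trace_pow_eq_sum_roots, hH.trace_pow_eq_sum_roots]
  exact ⟨fun h m => congrArg (fun s : Multiset ℝ => (s.map (· ^ m)).sum) h, Multiset.eq_of_sum_map_pow_eq⟩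

end Spectrum

/-! ### Intersection arrays, walk numbers and pair counts -/

section Arrays

variable {V : Type*}

/-- The vertex colouring `col` is a bipartition of the connected graph `G`, and the intersection
numbers of a vertex `x` are `c (col x) i` and `b (col x) i`, continued by zero. -/
structure HasArrays (G : SimpleGraph V) (col : V → Bool) (c b : Bool → ℕ → ℕ) : Prop where
  connected : G.Connected
  col_adj : ∀ {x y}, G.Adj x y → col y = !col x
  card_c : ∀ x y, {z | G.Adj y z ∧ G.dist x z + 1 = G.dist x y}.ncard = c (col x) (G.dist x y)
  card_b : ∀ x y, {z | G.Adj y z ∧ G.dist x z = G.dist x y + 1}.ncard = b (col x) (G.dist x y)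
  eq_zero : ∀ x i, (∀ y, G.dist x y ≠ i) → c (col x) i = 0 ∧ b (col x) i = 0

open Classical in
theorem IsDistanceBiregular.exists_hasArrays {G : SimpleGraph V} (hG : G.IsDistanceBiregular) :
    ∃ col c b, G.HasArrays col c b := by
  obtain ⟨⟨hconn, hreg⟩, X, Y, hXY, hbip, hX, hY⟩ := hG
  let col : V → Bool := fun x => decide (x ∈ X)
  have harr : ∀ x y, col x = col y → G.intersectionArray x = G.intersectionArray y := by
    intro x y h
    by_cases hx : x ∈ X
    · exact hX x hx y (by simpa [col, hx] using h)
    · have hy : y ∉ X := by simpa [col, hx] using h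
      have hx' : x ∈ X ∪ Y := hXY ▸ Set.mem_univ x
      have hy' : y ∈ X ∪ Y := hXY ▸ Set.mem_univ y
      exact hY x (hx'.resolve_left hx) y (hy'.resolve_left hy)
  have hnum : ∀ x₁ y₁ x₂ y₂, col x₁ = col x₂ → G.dist x₁ y₁ = G.dist x₂ y₂ →
      G.cNum x₁ y₁ = G.cNum x₂ y₂ ∧ G.bNum x₁ y₁ = G.bNum x₂ y₂ := by
    intro x₁ y₁ x₂ y₂ hcol hd
    have hmem : (G.dist x₁ y₁, G.cNum x₁ y₁, G.aNum x₁ y₁, G.bNum x₁ y₁) ∈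
        G.intersectionArray x₁ := ⟨_, y₁, rfl, rfl⟩
    rw [harr x₁ x₂ hcol] at hmem
    obtain ⟨i, y, hy, h⟩ := hmem
    simp only [Prod.mk.injEq] at h
    obtain ⟨rfl, hc, -, hb⟩ := h
    obtain ⟨hc', -, hb'⟩ := hreg x₂ _ y hy y₂ hd.symm
    exact ⟨hc.trans hc', hb.trans hb'⟩
  -- Evaluate `f` at any pair with starting colour `t` and distance `i`; the default 0 is the
  -- continuation beyond the end of the array.
  let num : (V → V → ℕ) → Bool → ℕ → ℕ := fun f t i =>
    if h : ∃ p : V × V, col p.1 = t ∧ G.dist p.1 p.2 = i then f h.choose.1 h.choose.2 else 0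
  have hpos : ∀ f : V → V → ℕ,
      (∀ x₁ y₁ x₂ y₂, col x₁ = col x₂ → G.dist x₁ y₁ = G.dist x₂ y₂ → f x₁ y₁ = f x₂ y₂) →
      ∀ x y, num f (col x) (G.dist x y) = f x y := by
    intro f hf x y
    have h : ∃ p : V × V, col p.1 = col x ∧ G.dist p.1 p.2 = G.dist x y := ⟨(x, y), rfl, rfl⟩
    simp only [num, dif_pos h]
    exact hf _ _ _ _ h.choose_spec.1 h.choose_spec.2
  have hneg : ∀ f x i, (∀ y, G.dist x y ≠ i) → num f (col x) i = 0 := by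
    intro f x i hi
    refine dif_neg ?_
    rintro ⟨⟨x', y'⟩, hcol, rfl⟩
    have hmem : (G.dist x' y', G.cNum x' y', G.aNum x' y', G.bNum x' y') ∈
        G.intersectionArray x' := ⟨_, y', rfl, rfl⟩
    rw [harr x' x hcol] at hmem
    obtain ⟨i, y, hy, h⟩ := hmem
    simp only [Prod.mk.injEq] at h
    exact hi y (hy.trans h.1.symm)
  refine ⟨col, num G.cNum, num G.bNum, hconn, ?_, fun x y => ?_, fun x y => ?_,
    fun x i hi => ⟨hneg _ x i hi, hneg _ x i hi⟩⟩
  · intro x y hxy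
    have hdisj := Set.disjoint_left.1 hbip.disjoint
    rcases hbip.mem_of_adj hxy with ⟨hx, hy⟩ | ⟨hx, hy⟩
    · have : y ∉ X := fun h => hdisj h hy
      simp [col, hx, this]
    · have : x ∉ X := fun h => hdisj h hx
      simp [col, hy, this]
  · rw [hpos _ fun _ _ _ _ h h' => (hnum _ _ _ _ h h').1, cNum]
    split_ifs with h0
    · simp [h0]
    · congr 1
      ext z
      simp only [Set.mem_inter_iff, Set.mem_ofPred_eq, distSphere]
      rw [dist_eq_one_iff_adj]
      have : G.dist x z + 1 = G.dist x y ↔ G.dist x z = G.dist x y - 1 := by omega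
      rw [this, and_comm]
  · rw [hpos _ fun _ _ _ _ h h' => (hnum _ _ _ _ h h').2, bNum]
    congr 1
    ext z
    simp only [Set.mem_inter_iff, Set.mem_ofPred_eq, distSphere]
    rw [dist_eq_one_iff_adj, and_comm]

/-- The number of walks of length `m` between two vertices at distance `h` in a graph with the
intersection numbers `c` and `b`. -/
noncomputable def walkCount (c b : ℕ → ℕ) : ℕ → ℕ → ℝ
  | 0, h => if h = 0 then 1 else 0
  | m + 1, h => c h * walkCount c b m (h - 1) + b h * walkCount c b m (h + 1)

/-- The number of vertices at distance `i` from `x` and `j` from `y`, where `x` has colour `t`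
and distance `h` from `y`. -/
noncomputable def pairCount (c b : Bool → ℕ → ℕ) (t : Bool) (i : ℕ) : ℕ → ℕ → ℝ
  | 0, h => if h = i then 1 else 0
  | 1, h => (c t h * pairCount c b t i 0 (h - 1) + b t h * pairCount c b t i 0 (h + 1)) /
      c (t ^^ i.bodd) 1
  | j + 2, h => (c t h * pairCount c b t i (j + 1) (h - 1) +
      b t h * pairCount c b t i (j + 1) (h + 1) - b (t ^^ i.bodd) j * pairCount c b t i j h) /
      c (t ^^ i.bodd) (j + 2)

namespace HasArrays

variable {G : SimpleGraph V} {col : V → Bool} {c b : Bool → ℕ → ℕ} (hG : G.HasArrays col c b)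

include hG

/-- Naming the classes is arbitrary; this handles valencies that match only after an exchange. -/
theorem flip : G.HasArrays (fun x => !col x) (fun t => c !t) (fun t => b !t) where
  connected := hG.connected
  col_adj h := by rw [hG.col_adj h]
  card_c x y := by simpa using hG.card_c x y
  card_b x y := by simpa using hG.card_b x y
  eq_zero x i hi := by simpa using hG.eq_zero x i hi

theorem col_eq (x y : V) : col y = (col x ^^ (G.dist x y).bodd) := by
  have key : ∀ {u v : V} (p : G.Walk u v), col v = (col u ^^ p.length.bodd) := by
    intro u v p
    induction p with
    | nil => simp
    | cons h p ih => simp [ih, hG.col_adj h]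
  obtain ⟨p, hp⟩ := hG.connected.exists_walk_length_eq_dist x y
  rw [key p, hp]

theorem dist_of_adj (x : V) {y z : V} (h : G.Adj y z) :
    G.dist x z + 1 = G.dist x y ∨ G.dist x z = G.dist x y + 1 := by
  have hne : G.dist x z ≠ G.dist x y := by
    intro heq
    have h1 := hG.col_eq x y
    have h2 := hG.col_eq x z
    rw [heq, ← h1, hG.col_adj h] at h2
    simp at h2
  have := h.diff_dist_adj (u := x)
  omega

theorem exists_pred {x y : V} {i : ℕ} (h : G.dist x y = i + 1) :
    ∃ z, G.Adj y z ∧ G.dist x z = i := by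
  obtain ⟨p, hp⟩ := hG.connected.exists_walk_length_eq_dist y x
  rw [dist_comm, h] at hp
  cases p with
  | nil => simp at hp
  | @cons _ z _ hadj p =>
    refine ⟨z, hadj, ?_⟩
    have h1 := dist_le p
    rw [dist_comm] at h1
    have h2 := hG.dist_of_adj x hadj
    simp only [Walk.length_cons] at hp
    omega

theorem exists_dist_eq {x y : V} {j : ℕ} :
    j ≤ G.dist x y → ∃ z, G.dist x z = j := by
  intro h
  induction h using Nat.decreasingInduction with
  | self => exact ⟨y, rfl⟩
  | of_succ k _ ih =>
    obtain ⟨z, hz⟩ := ih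
    obtain ⟨w, -, hw⟩ := hG.exists_pred hz
    exact ⟨w, hw⟩

theorem exists_adj [Nontrivial V] (x : V) :
    ∃ y, G.Adj x y := by
  obtain ⟨y, hy⟩ := exists_ne x
  obtain ⟨i, hi⟩ := Nat.exists_eq_succ_of_ne_zero (hG.connected.pos_dist_of_ne hy).ne'
  obtain ⟨z, hz, -⟩ := hG.exists_pred (x := y) (y := x) hi
  exact ⟨z, hz⟩

theorem exists_col [Nontrivial V] (t : Bool) :
    ∃ x, col x = t := by
  obtain ⟨x⟩ := hG.connected.nonempty
  obtain ⟨y, hy⟩ := hG.exists_adj x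
  have := hG.col_adj hy
  by_cases h : col x = t
  · exact ⟨x, h⟩
  · exact ⟨y, by rw [this]; revert h; cases col x <;> cases t <;> simp⟩

theorem c_zero (x : V) : c (col x) 0 = 0 := by
  have := hG.card_c x x
  simpa using this.symm

theorem c_ne_zero [Finite V] {x y : V} {i : ℕ} (h : G.dist x y = i + 1) :
    c (col x) (i + 1) ≠ 0 := by
  obtain ⟨z, hz, hd⟩ := hG.exists_pred h
  rw [← h, ← hG.card_c x y, ← Nat.pos_iff_ne_zero, Set.ncard_pos]
  exact ⟨z, hz, by omega⟩

theorem b_ne_zero_iff [Finite V] {x : V} {i : ℕ} :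
    b (col x) i ≠ 0 ↔ ∃ y, G.dist x y = i + 1 := by
  constructor
  · intro h
    obtain ⟨y, rfl⟩ : ∃ y, G.dist x y = i := by
      by_contra! hi
      exact h (hG.eq_zero x i hi).2
    rw [← hG.card_b x y, ← Nat.pos_iff_ne_zero, Set.ncard_pos] at h
    obtain ⟨z, -, hz⟩ := h
    exact ⟨z, hz⟩
  · rintro ⟨y, hy⟩
    obtain ⟨z, hz, rfl⟩ := hG.exists_pred hy
    rw [← hG.card_b x z, ← Nat.pos_iff_ne_zero, Set.ncard_pos]
    exact ⟨y, hz.symm, hy⟩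

variable [Fintype V]

-- The adjacency operator preserves functions of the distance from `x` and acts on them
-- tridiagonally. The truncated `- 1` at distance 0 is harmless as $c_0=0$.
open Classical in
theorem sum_adjMatrix_mul (x y : V) (g : ℕ → ℝ) :
    ∑ z, G.adjMatrix ℝ y z * g (G.dist x z) =
      c (col x) (G.dist x y) * g (G.dist x y - 1) + b (col x) (G.dist x y) * g (G.dist x y + 1) := by
  rw [← hG.card_c, ← hG.card_b, Set.ncard_eq_toFinset_card', Set.ncard_eq_toFinset_card',
    Set.toFinset_ofPred, Set.toFinset_ofPred, Finset.card_filter, Finset.card_filter]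
  push_cast
  rw [Finset.sum_mul, Finset.sum_mul, ← Finset.sum_add_distrib]
  refine Finset.sum_congr rfl fun z _ => ?_
  by_cases h : G.Adj y z
  · rcases hG.dist_of_adj x h with hd | hd
    · have h1 : G.dist x y - 1 = G.dist x z := by omega
      have h2 : G.dist x z ≠ G.dist x y + 1 := by omega
      simp [adjMatrix_apply, h, hd, h1, h2]
    · have h2 : G.dist x z + 1 ≠ G.dist x y := by omega
      simp [adjMatrix_apply, h, hd]
      omega
  · simp [adjMatrix_apply, h]

open Classical in
theorem sum_adjMatrix (x : V) : ∑ z, G.adjMatrix ℝ x z = b (col x) 0 := by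
  simpa [hG.c_zero x] using hG.sum_adjMatrix_mul x x fun _ => 1

theorem c_add_b (x y : V) :
    c (col x) (G.dist x y) + b (col x) (G.dist x y) = b (col y) 0 := by
  classical
  have := hG.sum_adjMatrix_mul x y fun _ => 1
  simp only [mul_one, hG.sum_adjMatrix] at this
  exact_mod_cast this.symm

open Classical in
theorem adjMatrix_pow_apply (x : V) (m : ℕ) : ∀ y,
    (G.adjMatrix ℝ ^ m) x y = walkCount (c (col x)) (b (col x)) m (G.dist x y) := by
  induction m with
  | zero =>
    intro y
    simp [walkCount, Matrix.one_apply, hG.connected.dist_eq_zero_iff]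
  | succ m ih =>
    intro y
    rw [pow_succ, Matrix.mul_apply, walkCount,
      ← hG.sum_adjMatrix_mul x y (walkCount (c (col x)) (b (col x)) m)]
    refine Finset.sum_congr rfl fun z _ => ?_
    rw [ih, mul_comm, adjMatrix_apply, adjMatrix_apply, adj_comm]

-- Exchange the sums and look from `z`: a neighbour of `y` lies at distance `j` from `z` only if `y`
-- is at distance `j + 1` or `j - 1`. The colour of `z` is that of `x` shifted by the parity of `i`.
open Classical in
theorem sum_adjMatrix_mul_card_pair (x y : V) (i j : ℕ) :
    ∑ y', G.adjMatrix ℝ y y' * ∑ z, (if G.dist x z = i ∧ G.dist z y' = j then (1 : ℝ) else 0) =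
      c (col x ^^ i.bodd) (j + 1) *
        ∑ z, (if G.dist x z = i ∧ G.dist z y = j + 1 then (1 : ℝ) else 0) +
      if j = 0 then 0 else b (col x ^^ i.bodd) (j - 1) *
        ∑ z, (if G.dist x z = i ∧ G.dist z y = j - 1 then (1 : ℝ) else 0) := by
  have hstep : (if j = 0 then (0 : ℝ) else b (col x ^^ i.bodd) (j - 1) *
        ∑ z, (if G.dist x z = i ∧ G.dist z y = j - 1 then (1 : ℝ) else 0)) =
      ∑ z, if j = 0 then (0 : ℝ) else b (col x ^^ i.bodd) (j - 1) *
        (if G.dist x z = i ∧ G.dist z y = j - 1 then (1 : ℝ) else 0) := by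
    rcases eq_or_ne j 0 with h | h
    · simp [h]
    · simp only [if_neg h, Finset.mul_sum]
  rw [hstep]
  simp only [Finset.mul_sum]
  rw [Finset.sum_comm, ← Finset.sum_add_distrib]
  refine Finset.sum_congr rfl fun z _ => ?_
  by_cases hz : G.dist x z = i
  · simp only [hz, true_and]
    rw [hG.sum_adjMatrix_mul z y fun h => if h = j then 1 else 0, ← hz, ← hG.col_eq x z]
    have h0 := hG.c_zero z
    congr 1
    · rcases Nat.eq_zero_or_pos (G.dist z y) with h | h
      · simp [h, h0]
      · by_cases h' : G.dist z y = j + 1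
        · simp [h']
        · have : G.dist z y - 1 ≠ j := by omega
          simp [h', this]
    · rcases j with _ | j
      · simp
      · by_cases h' : G.dist z y = j
        · simp [h']
        · simp [h']
  · simp [hz]

-- Evaluate the neighbour sum of the previous lemma also from `x`, where by induction it is a
-- function of distance, and solve for the count at `j + 1`.
open Classical in
theorem sum_ite_dist_eq_pairCount (x : V) (i : ℕ) : ∀ j y,
    ∑ z, (if G.dist x z = i ∧ G.dist z y = j then (1 : ℝ) else 0) =
      pairCount c b (col x) i j (G.dist x y) := by
  have hdiv : ∀ {y j} {r : ℝ}, r = c (col x ^^ i.bodd) (j + 1) *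
      ∑ z, (if G.dist x z = i ∧ G.dist z y = j + 1 then (1 : ℝ) else 0) →
      ∑ z, (if G.dist x z = i ∧ G.dist z y = j + 1 then (1 : ℝ) else 0) =
        r / c (col x ^^ i.bodd) (j + 1) := by
    rintro y j r rfl
    -- If the divisor vanishes, no pair is counted, in agreement with division by zero giving 0.
    by_cases hc : c (col x ^^ i.bodd) (j + 1) = 0
    · rw [hc]
      simp only [Nat.cast_zero, div_zero]
      refine Finset.sum_eq_zero fun z _ => if_neg ?_
      rintro ⟨rfl, hz⟩
      rw [← hG.col_eq x z] at hc
      exact hG.c_ne_zero hz hc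
    · have : (c (col x ^^ i.bodd) (j + 1) : ℝ) ≠ 0 := by exact_mod_cast hc
      field_simp
  intro j
  induction j using Nat.strong_induction_on with
  | _ j ih =>
    intro y
    match j, ih with
    | 0, _ =>
      simp only [hG.connected.dist_eq_zero_iff, pairCount]
      rw [Finset.sum_eq_single y]
      · simp
      · intro z _ hz; simp [hz]
      · simp
    | 1, ih =>
      have h := hG.sum_adjMatrix_mul_card_pair x y i 0
      simp only [ih 0 (by omega), hG.sum_adjMatrix_mul] at h
      rw [pairCount]
      exact hdiv (by simpa using h)
    | j + 2, ih =>
      have h := hG.sum_adjMatrix_mul_card_pair x y i (j + 1)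
      simp only [ih (j + 1) (by omega), hG.sum_adjMatrix_mul] at h
      rw [pairCount]
      refine hdiv ?_
      rw [h, ← ih j (by omega) y]
      simp

end HasArrays

theorem hasArrays_of_subsingleton {G : SimpleGraph V} [Subsingleton V] (hG : G.Connected) :
    G.HasArrays (fun _ => true) (fun _ _ => 0) (fun _ _ => 0) where
  connected := hG
  col_adj {x y} h := absurd (Subsingleton.elim x y) h.ne
  card_c x y := by
    have : ∀ z, ¬ G.Adj y z := fun z h => h.ne (Subsingleton.elim y z)
    simp [this]
  card_b x y := by
    have : ∀ z, ¬ G.Adj y z := fun z h => h.ne (Subsingleton.elim y z)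
    simp [this]
  eq_zero _ _ _ := ⟨rfl, rfl⟩

end Arrays

/-! ### Equal arrays imply $C^3$-equivalence -/

section Pebble

open Function

variable {V W : Type*} [Fintype V] [Fintype W] {G : SimpleGraph V} {H : SimpleGraph W}
  {col : V → Bool} {col' : W → Bool} {c b : Bool → ℕ → ℕ}

theorem HasArrays.exists_equiv_dist (hG : G.HasArrays col c b) (hH : H.HasArrays col' c b)
    {x y : V} {x' y' : W} (hcol : col x = col' x') (hd : G.dist x y = H.dist x' y') :
    ∃ σ : V ≃ W, ∀ z, H.dist x' (σ z) = G.dist x z ∧ H.dist (σ z) y' = G.dist z y := by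
  classical
  obtain ⟨σ, hσ⟩ := exists_equiv_of_card_fiber_eq (f := fun z => (G.dist x z, G.dist z y))
    (g := fun z => (H.dist x' z, H.dist z y')) (by
      rintro ⟨i, j⟩
      have h1 := hG.sum_ite_dist_eq_pairCount x i j y
      have h2 := hH.sum_ite_dist_eq_pairCount x' i j y'
      rw [hcol, hd, ← h2, Finset.sum_boole, Finset.sum_boole] at h1
      rw [Nat.card_eq_fintype_card, Nat.card_eq_fintype_card, Fintype.card_subtype,
        Fintype.card_subtype]
      simpa using h1)
  exact ⟨σ, fun z => by simpa using hσ z⟩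

theorem HasArrays.realize_iff (hG : G.HasArrays col c b) (hH : H.HasArrays col' c b)
    (φ : CFormula 3) : ∀ {v : Fin 3 → V} {w : Fin 3 → W},
      (∀ i, col (v i) = col' (w i)) → (∀ i j, G.dist (v i) (v j) = H.dist (w i) (w j)) →
      (φ.Realize G v ↔ φ.Realize H w) := by
  have step : ∀ {v : Fin 3 → V} {w : Fin 3 → W} (k : Fin 3),
      (∀ i, col (v i) = col' (w i)) → (∀ i j, G.dist (v i) (v j) = H.dist (w i) (w j)) →
      ∃ σ : V ≃ W, ∀ z, (∀ i, col (update v k z i) = col' (update w k (σ z) i)) ∧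
        ∀ i j, G.dist (update v k z i) (update v k z j) =
          H.dist (update w k (σ z) i) (update w k (σ z) j) := by
    intro v w k hcol hd
    obtain ⟨i, j, hik, hjk, hall⟩ : ∃ i j : Fin 3, i ≠ k ∧ j ≠ k ∧
        ∀ l, l = k ∨ l = i ∨ l = j := by decide +revert
    obtain ⟨σ, hσ⟩ := hG.exists_equiv_dist hH (hcol i) (hd i j)
    have hdz : ∀ z l, l ≠ k → G.dist z (v l) = H.dist (σ z) (w l) := by
      intro z l hl
      rcases hall l with rfl | rfl | rfl
      · exact absurd rfl hl
      · rw [dist_comm, ← (hσ z).1, dist_comm]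
      · exact (hσ z).2.symm
    refine ⟨σ, fun z => ⟨fun l => ?_, fun l m => ?_⟩⟩
    · by_cases hl : l = k
      · subst hl
        -- The colour of the moved pebble follows from the parity of its distance to pebble `i`.
        rw [update_self, update_self, hG.col_eq (v i), hH.col_eq (w i), (hσ z).1, hcol]
      · rw [update_of_ne hl, update_of_ne hl, hcol]
    · by_cases hl : l = k <;> by_cases hm : m = k
      · subst hl hm; simp
      · subst hl
        rw [update_self, update_self, update_of_ne hm, update_of_ne hm, hdz z m hm]
      · subst hm
        rw [update_self, update_self, update_of_ne hl, update_of_ne hl, dist_comm, hdz z l hl,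
          dist_comm]
      · rw [update_of_ne hl, update_of_ne hm, update_of_ne hl, update_of_ne hm, hd]
  induction φ with
  | eq i j =>
    intro v w _ hd
    simp only [CFormula.Realize]
    rw [← hG.connected.dist_eq_zero_iff, hd, hH.connected.dist_eq_zero_iff]
  | adj i j =>
    intro v w _ hd
    simp only [CFormula.Realize]
    rw [← dist_eq_one_iff_adj, hd, dist_eq_one_iff_adj]
  | not φ ih => intro v w h h'; exact not_congr (ih h h')
  | and φ ψ ih₁ ih₂ => intro v w h h'; exact and_congr (ih₁ h h') (ih₂ h h')
  | or φ ψ ih₁ ih₂ => intro v w h h'; exact or_congr (ih₁ h h') (ih₂ h h')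
  | imp φ ψ ih₁ ih₂ => intro v w h h'; exact imp_congr (ih₁ h h') (ih₂ h h')
  | iff φ ψ ih₁ ih₂ => intro v w h h'; exact iff_congr (ih₁ h h') (ih₂ h h')
  | ex i φ ih =>
    intro v w h h'
    obtain ⟨σ, hσ⟩ := step i h h'
    exact σ.exists_congr fun z => ih (hσ z).1 (hσ z).2
  | all i φ ih =>
    intro v w h h'
    obtain ⟨σ, hσ⟩ := step i h h'
    exact σ.forall_congr fun z => ih (hσ z).1 (hσ z).2
  | exGe n i φ ih =>
    intro v w h h'
    obtain ⟨σ, hσ⟩ := step i h h'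
    refine σ.finsetCongr.exists_congr fun s => ?_
    simp only [Equiv.finsetCongr_apply, Finset.card_map, Finset.forall_mem_map]
    exact and_congr_right fun _ => forall₂_congr fun z _ => ih (hσ z).1 (hσ z).2

theorem HasArrays.cEquiv (hG : G.HasArrays col c b) (hH : H.HasArrays col' c b)
    {x : V} {x' : W} (hcol : col x = col' x') : CEquiv 3 G H := by
  intro φ hφ
  rw [hφ.satisfies_iff fun _ => x, hφ.satisfies_iff fun _ => x']
  exact hG.realize_iff hH φ (fun _ => hcol) fun _ _ => by simp

end Pebble

/-! ### Recovering the array from closed walk numbers -/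

section WalkCount

theorem walkCount_eq_zero {c b : ℕ → ℕ} : ∀ {m h : ℕ}, m < h → walkCount c b m h = 0
  | 0, h, hh => by simp [walkCount, hh.ne']
  | m + 1, h, hh => by
    rw [walkCount, walkCount_eq_zero (show m < h - 1 by omega),
      walkCount_eq_zero (show m < h + 1 by omega)]
    simp

theorem walkCount_self (c b : ℕ → ℕ) (m : ℕ) :
    walkCount c b m m = ∏ j ∈ Finset.range m, (c (j + 1) : ℝ) := by
  induction m with
  | zero => simp [walkCount]
  | succ m ih =>
    rw [walkCount, walkCount_eq_zero (show m < m + 1 + 1 by omega), Nat.add_sub_cancel, ih,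
      Finset.prod_range_succ]
    ring

variable {c b c' b' : ℕ → ℕ} {i : ℕ}

/-- A walk of length `m` ending at distance `l` must go to distance `i + 1` and back to level `l` to
involve later entries; the bound on `m + l` excludes this. -/
theorem walkCount_congr (h : ∀ j ≤ i, c j = c' j ∧ b j = b' j) :
    ∀ {m l : ℕ}, m + l ≤ 2 * i + 1 → walkCount c b m l = walkCount c' b' m l
  | 0, l, _ => by simp [walkCount]
  | m + 1, l, hml => by
    by_cases hl : l ≤ i
    · rw [walkCount, walkCount, walkCount_congr h (show m + (l - 1) ≤ 2 * i + 1 by omega),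
        walkCount_congr h (show m + (l + 1) ≤ 2 * i + 1 by omega), (h l hl).1, (h l hl).2]
    · rw [walkCount_eq_zero (show m + 1 < l by omega), walkCount_eq_zero (show m + 1 < l by omega)]

theorem eq_of_walkCount_eq (h : ∀ j ≤ i, c j = c' j ∧ b j = b' j) (hb : ∀ j ≤ i, b j ≠ 0)
    (hc : ∀ j < i, c (j + 1) ≠ 0)
    (hw : walkCount c b (2 * i + 2) 0 = walkCount c' b' (2 * i + 2) 0) :
    c (i + 1) = c' (i + 1) := by
  -- Climb the antidiagonal from `l = 0`: in the recursion the term at `l - 1` is already known, so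
  -- cancelling `b l` gives the one at `l + 1`. At its end `m = l = i + 1` stands $c_1\cdots
  -- c_{i+1}$.
  have key : ∀ l m, m + l = 2 * i + 2 → l ≤ i + 1 → walkCount c b m l = walkCount c' b' m l := by
    intro l
    induction l with
    | zero => rintro m rfl _; exact hw
    | succ l ih =>
      intro m hm hl
      have h1 := ih (m + 1) (by omega) (by omega)
      have hl' : l ≤ i := by omega
      rw [walkCount, walkCount, walkCount_congr h (show m + (l - 1) ≤ 2 * i + 1 by omega),
        ← (h l hl').1, ← (h l hl').2] at h1
      have h2 : (b l : ℝ) ≠ 0 := by exact_mod_cast hb l hl'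
      exact mul_left_cancel₀ h2 (add_left_cancel h1)
  have h1 := key (i + 1) (i + 1) (by omega) le_rfl
  rw [walkCount_self, walkCount_self, Finset.prod_range_succ, Finset.prod_range_succ,
    Finset.prod_congr rfl fun j hj => by rw [(h (j + 1) (Finset.mem_range.1 hj)).1]] at h1
  have h2 : ∏ j ∈ Finset.range i, (c' (j + 1) : ℝ) ≠ 0 := by
    refine Finset.prod_ne_zero_iff.2 fun j hj => ?_
    have hj := Finset.mem_range.1 hj
    rw [← (h (j + 1) hj).1]
    exact_mod_cast hc j hj
  exact_mod_cast mul_left_cancel₀ h2 h1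

end WalkCount

/-! ### Row sums from the growth of traces -/

section Growth

theorem le_of_forall_pow_le_mul_pow {a b C : ℝ} (hb : 0 ≤ b)
    (h : ∀ i : ℕ, a ^ i ≤ C * b ^ i) : a ≤ b := by
  by_contra! hab
  rcases hb.eq_or_lt with rfl | hb
  · have := h 1
    simp at this
    linarith
  · obtain ⟨i, hi⟩ := pow_unbounded_of_one_lt C ((one_lt_div hb).2 hab)
    rw [div_pow, lt_div_iff₀ (pow_pos hb i)] at hi
    exact absurd (h i) (not_le.2 hi)

variable {n : Type*} [Fintype n] [DecidableEq n] {M : Matrix n n ℝ} {q : ℝ}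

theorem _root_.Matrix.sum_pow_apply_of_sum_apply (hM : ∀ x, ∑ y, M x y = q) (i : ℕ) (x : n) :
    ∑ y, (M ^ i) x y = q ^ i := by
  induction i generalizing x with
  | zero => simp [Matrix.one_apply]
  | succ i ih =>
    simp_rw [pow_succ, Matrix.mul_apply]
    rw [Finset.sum_comm]
    simp_rw [← Finset.mul_sum, hM, ← Finset.sum_mul, ih]

theorem _root_.Matrix.trace_pow_le_of_sum_apply (hM : ∀ x, ∑ y, M x y = q)
    (h0 : ∀ i x y, 0 ≤ (M ^ i) x y) (i : ℕ) : (M ^ i).trace ≤ Fintype.card n * q ^ i := by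
  calc (M ^ i).trace ≤ ∑ _x : n, q ^ i := by
        refine Finset.sum_le_sum fun x _ => ?_
        rw [← Matrix.sum_pow_apply_of_sum_apply hM i x]
        exact Finset.single_le_sum (f := fun y => (M ^ i) x y) (fun y _ => h0 i x y)
          (Finset.mem_univ x)
    _ = _ := by simp

/-- The trace is the sum of the squared entries of `M ^ i`; apply Cauchy–Schwarz to each row, whose
sum is `q ^ i`. -/
theorem _root_.Matrix.IsSymm.pow_le_trace_of_sum_apply [Nonempty n] (hs : M.IsSymm)
    (hM : ∀ x, ∑ y, M x y = q) (i : ℕ) : (q ^ 2) ^ i ≤ (M ^ (2 * i)).trace := by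
  have hn : (0 : ℝ) < Fintype.card n := by exact_mod_cast Fintype.card_pos
  have hsq : (M ^ (2 * i)).trace = ∑ x, ∑ y, (M ^ i) x y ^ 2 := by
    rw [two_mul, pow_add]
    refine Finset.sum_congr rfl fun x _ => ?_
    rw [Matrix.diag_apply, Matrix.mul_apply]
    refine Finset.sum_congr rfl fun y _ => ?_
    rw [(hs.pow i).apply, sq]
  rw [hsq]
  refine le_of_mul_le_mul_left ?_ hn
  calc (Fintype.card n : ℝ) * (q ^ 2) ^ i = ∑ x : n, (∑ y, (M ^ i) x y) ^ 2 := by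
        simp [Matrix.sum_pow_apply_of_sum_apply hM, pow_right_comm]
    _ ≤ ∑ x : n, (Fintype.card n : ℝ) * ∑ y, (M ^ i) x y ^ 2 :=
        Finset.sum_le_sum fun x _ => sq_sum_le_card_mul_sum_sq
    _ = _ := by rw [Finset.mul_sum]

end Growth

/-! ### Traces and the two colour classes -/

section Traces

variable {V : Type*} [Fintype V] {G : SimpleGraph V} {col : V → Bool} {c b : Bool → ℕ → ℕ}

open Classical

theorem HasArrays.sum_adjMatrix_sq (hG : G.HasArrays col c b) (x : V) :
    ∑ y, (G.adjMatrix ℝ ^ 2) x y = b true 0 * b false 0 := by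
  simp_rw [sq, Matrix.mul_apply]
  rw [Finset.sum_comm]
  simp_rw [← Finset.mul_sum, hG.sum_adjMatrix]
  have : ∀ z, G.adjMatrix ℝ x z * (b (col z) 0 : ℝ) = G.adjMatrix ℝ x z * b (!col x) 0 := by
    intro z
    by_cases h : G.Adj x z
    · rw [hG.col_adj h]
    · simp [adjMatrix_apply, h]
  simp_rw [this, ← Finset.sum_mul, hG.sum_adjMatrix]
  cases col x <;> simp [mul_comm]

/-- Moving the first step of a closed walk to its end shifts its base point to the other class.
Length 0 is excluded, as the classes may differ in size. -/
theorem HasArrays.two_mul_sum_filter (hG : G.HasArrays col c b) (m : ℕ) (t : Bool) :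
    2 * ∑ x with col x = t, (G.adjMatrix ℝ ^ (m + 1)) x x = (G.adjMatrix ℝ ^ (m + 1)).trace := by
  have hswap : ∑ x with col x = t, (G.adjMatrix ℝ ^ (m + 1)) x x =
      ∑ x with ¬ col x = t, (G.adjMatrix ℝ ^ (m + 1)) x x := by
    simp only [Finset.sum_filter]
    conv_lhs => rw [pow_succ']
    conv_rhs => rw [pow_succ]
    simp only [Matrix.mul_apply]
    have h1 : ∀ x, (if col x = t then ∑ y, G.adjMatrix ℝ x y * (G.adjMatrix ℝ ^ m) y x else 0) =
        ∑ y, if col x = t then G.adjMatrix ℝ x y * (G.adjMatrix ℝ ^ m) y x else 0 := by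
      intro x; split_ifs <;> simp
    have h2 : ∀ x, (if ¬ col x = t then ∑ y, (G.adjMatrix ℝ ^ m) x y * G.adjMatrix ℝ y x else 0) =
        ∑ y, if ¬ col x = t then (G.adjMatrix ℝ ^ m) x y * G.adjMatrix ℝ y x else 0 := by
      intro x; split_ifs <;> simp
    simp only [h1, h2]
    rw [Finset.sum_comm]
    refine Finset.sum_congr rfl fun y _ => Finset.sum_congr rfl fun x _ => ?_
    by_cases h : G.Adj x y
    · have : col x = t ↔ ¬ col y = t := by
        rw [hG.col_adj h]
        cases col x <;> cases t <;> simp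
      simp only [this, mul_comm]
    · simp [adjMatrix_apply, h]
  rw [two_mul]
  nth_rw 2 [hswap]
  exact Finset.sum_filter_add_sum_filter_not _ _ _

theorem HasArrays.two_mul_card_mul_walkCount (hG : G.HasArrays col c b) (m : ℕ) (t : Bool) :
    2 * ((Finset.univ.filter fun x => col x = t).card * walkCount (c t) (b t) (m + 1) 0) =
      (G.adjMatrix ℝ ^ (m + 1)).trace := by
  rw [← hG.two_mul_sum_filter m t, ← nsmul_eq_mul, ← Finset.sum_const]
  congr 1
  refine Finset.sum_congr rfl fun x hx => ?_
  rw [hG.adjMatrix_pow_apply, dist_self, (Finset.mem_filter.1 hx).2]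

theorem HasArrays.two_mul_card_mul_b (hG : G.HasArrays col c b) (t : Bool) :
    2 * ((Finset.univ.filter fun x => col x = t).card * (b t 0 : ℝ)) =
      (G.adjMatrix ℝ ^ 2).trace := by
  rw [← hG.two_mul_sum_filter 1 t, ← nsmul_eq_mul, ← Finset.sum_const]
  congr 1
  refine Finset.sum_congr rfl fun x hx => ?_
  rw [← (Finset.mem_filter.1 hx).2, ← hG.sum_adjMatrix, sq, Matrix.mul_apply]
  refine Finset.sum_congr rfl fun y _ => ?_
  simp [adjMatrix_apply, adj_comm]

theorem card_filter_true_add_card_filter_false (col : V → Bool) :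
    ((Finset.univ.filter fun x => col x = true).card : ℝ) +
      (Finset.univ.filter fun x => col x = false).card = Fintype.card V := by
  have := Finset.card_filter_add_card_filter_not (s := (Finset.univ : Finset V))
    (fun x => col x = true)
  simp only [Bool.not_eq_true, Finset.card_univ] at this
  exact_mod_cast this

theorem HasArrays.b_zero_ne_zero [Nontrivial V] (hG : G.HasArrays col c b) (t : Bool) :
    b t 0 ≠ 0 := by
  obtain ⟨x, rfl⟩ := hG.exists_col t
  obtain ⟨y, hy⟩ := hG.exists_adj x
  exact hG.b_ne_zero_iff.2 ⟨y, dist_eq_one_iff_adj.2 hy⟩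

end Traces

/-! ### Cospectral graphs have the same arrays -/

section Cospectral

variable {V W : Type*} [Fintype V] [Fintype W] {G : SimpleGraph V} {H : SimpleGraph W}
  {col : V → Bool} {col' : W → Bool} {c b c' b' : Bool → ℕ → ℕ}

theorem Cospectral.symm (h : G.Cospectral H) : H.Cospectral G :=
  Eq.symm h

theorem Cospectral.card_eq (h : G.Cospectral H) : Fintype.card V = Fintype.card W := by
  have := cospectral_iff_trace_adjMatrix_pow.1 h 0
  simpa [Matrix.trace_one] using this

/-- Both growth bounds, applied to the squared adjacency matrices, compare their row sums without
Perron–Frobenius theory. -/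
theorem HasArrays.valency_mul_le (hG : G.HasArrays col c b) (hH : H.HasArrays col' c' b')
    (h : G.Cospectral H) :
    (b true 0 * b false 0 : ℝ) ≤ b' true 0 * b' false 0 := by
  classical
  have := hG.connected.nonempty
  have htr := cospectral_iff_trace_adjMatrix_pow.1 h
  refine (pow_le_pow_iff_left₀ (by positivity) (by positivity) two_ne_zero).1 ?_
  refine le_of_forall_pow_le_mul_pow (C := Fintype.card W) (by positivity) fun i => ?_
  have hs : (G.adjMatrix ℝ).IsSymm := transpose_adjMatrix _
  have hnonneg : ∀ j x y, 0 ≤ ((H.adjMatrix ℝ ^ 2) ^ j) x y := fun j x y => by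
    rw [← pow_mul, adjMatrix_pow_apply_eq_card_walk]
    positivity
  calc ((b true 0 * b false 0 : ℝ) ^ 2) ^ i ≤ ((G.adjMatrix ℝ ^ 2) ^ (2 * i)).trace :=
        (hs.pow 2).pow_le_trace_of_sum_apply hG.sum_adjMatrix_sq i
    _ = ((H.adjMatrix ℝ ^ 2) ^ (2 * i)).trace := by rw [← pow_mul, ← pow_mul, htr]
    _ ≤ _ := Matrix.trace_pow_le_of_sum_apply hH.sum_adjMatrix_sq hnonneg (2 * i)
    _ = _ := by rw [pow_mul]

theorem HasArrays.valency_eq_or [Nontrivial V] [Nontrivial W] (hG : G.HasArrays col c b)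
    (hH : H.HasArrays col' c' b') (h : G.Cospectral H) :
    (∀ t, b t 0 = b' t 0) ∨ ∀ t, b t 0 = b' (!t) 0 := by
  classical
  have hq := le_antisymm (hG.valency_mul_le hH h) (hH.valency_mul_le hG h.symm)
  have htr := cospectral_iff_trace_adjMatrix_pow.1 h 2
  have hk := hG.two_mul_card_mul_b true
  have hl := hG.two_mul_card_mul_b false
  have hk' := hH.two_mul_card_mul_b true
  have hl' := hH.two_mul_card_mul_b false
  rw [← htr] at hk' hl'
  have hn := card_filter_true_add_card_filter_false col
  have hn' := card_filter_true_add_card_filter_false col'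
  rw [← h.card_eq, ← hn] at hn'
  have hNt : (0 : ℝ) < (Finset.univ.filter fun x => col x = true).card := by
    obtain ⟨x, hx⟩ := hG.exists_col true
    exact_mod_cast Finset.card_pos.2 ⟨x, by simpa using hx⟩
  have hk0 : (0 : ℝ) < b true 0 := by exact_mod_cast Nat.pos_of_ne_zero (hG.b_zero_ne_zero true)
  generalize (G.adjMatrix ℝ ^ 2).trace = T at *
  have hT : T ≠ 0 := by rw [← hk]; positivity
  -- With $T=\operatorname{tr}A^2$ the classes have sizes $T/2k$ and $T/2l$, so $T(k+l)=2kl\,|V|$.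
  have hsum : (b true 0 + b false 0 : ℝ) = b' true 0 + b' false 0 := by
    refine mul_left_cancel₀ hT ?_
    linear_combination (-(b false 0 : ℝ)) * hk - (b true 0 : ℝ) * hl
      + (b' false 0 : ℝ) * hk' + (b' true 0 : ℝ) * hl'
      - 2 * (b' true 0 * b' false 0 : ℝ) * hn'
      + 2 * ((Finset.univ.filter fun x => col x = true).card +
        (Finset.univ.filter fun x => col x = false).card : ℝ) * hq
  have hprod : (b true 0 - b' true 0 : ℝ) * (b true 0 - b' false 0) = 0 := by
    linear_combination (b true 0 : ℝ) * hsum - hq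
  rcases mul_eq_zero.1 hprod with h0 | h0
  · left
    have h1 : (b true 0 : ℝ) = b' true 0 := by linarith
    have h2 : (b false 0 : ℝ) = b' false 0 := by linarith
    rintro (_ | _)
    · exact_mod_cast h2
    · exact_mod_cast h1
  · right
    have h1 : (b true 0 : ℝ) = b' false 0 := by linarith
    have h2 : (b false 0 : ℝ) = b' true 0 := by linarith
    rintro (_ | _)
    · exact_mod_cast h2
    · exact_mod_cast h1

theorem HasArrays.eq_of_valency_eq [Nontrivial V] [Nontrivial W] (hG : G.HasArrays col c b)
    (hH : H.HasArrays col' c' b') (h : G.Cospectral H) (hval : ∀ t, b t 0 = b' t 0) :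
    c = c' ∧ b = b' := by
  suffices key : ∀ t i, ∀ j ≤ i, c t j = c' t j ∧ b t j = b' t j from
    ⟨funext₂ fun t i => (key t i i le_rfl).1, funext₂ fun t i => (key t i i le_rfl).2⟩
  intro t
  have htr := cospectral_iff_trace_adjMatrix_pow.1 h
  obtain ⟨x, hx⟩ := hG.exists_col t
  obtain ⟨x', hx'⟩ := hH.exists_col t
  have hN : ((Finset.univ.filter fun x => col x = t).card : ℝ) =
      (Finset.univ.filter fun x => col' x = t).card := by
    have h1 := (hG.two_mul_card_mul_b t).trans ((htr 2).trans (hH.two_mul_card_mul_b t).symm)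
    rw [← hval t] at h1
    have h2 : (b t 0 : ℝ) ≠ 0 := by exact_mod_cast hG.b_zero_ne_zero t
    exact mul_right_cancel₀ h2 (mul_left_cancel₀ two_ne_zero h1)
  have hNpos : ((Finset.univ.filter fun x => col x = t).card : ℝ) ≠ 0 := by
    exact_mod_cast (Finset.card_pos.2 ⟨x, by simpa using hx⟩).ne'
  have hwalk : ∀ m, walkCount (c t) (b t) (m + 1) 0 = walkCount (c' t) (b' t) (m + 1) 0 := by
    intro m
    have h1 := (hG.two_mul_card_mul_walkCount m t).trans
      ((htr (m + 1)).trans (hH.two_mul_card_mul_walkCount m t).symm)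
    rw [← hN] at h1
    exact mul_left_cancel₀ hNpos (mul_left_cancel₀ two_ne_zero h1)
  intro i
  induction i with
  | zero =>
    intro j hj
    obtain rfl : j = 0 := by omega
    refine ⟨?_, hval t⟩
    rw [← hx, hG.c_zero, hx, ← hx', hH.c_zero]
  | succ i ih =>
    intro j hj
    rcases Nat.lt_or_ge j (i + 1) with hlt | hge
    · exact ih j (by omega)
    obtain rfl : j = i + 1 := by omega
    have hbi := (ih i le_rfl).2
    -- If `b t i = 0`, both arrays have ended by `i` and continue by zero.
    by_cases hb0 : b t i = 0
    · have h1 := hG.eq_zero x (i + 1) (by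
        by_contra! hy
        exact hG.b_ne_zero_iff.2 hy (hx ▸ hb0))
      have h2 := hH.eq_zero x' (i + 1) (by
        by_contra! hy
        exact hH.b_ne_zero_iff.2 hy (hx' ▸ hbi ▸ hb0))
      rw [hx] at h1
      rw [hx'] at h2
      rw [h1.1, h1.2, h2.1, h2.2]
      exact ⟨rfl, rfl⟩
    · obtain ⟨y, hy⟩ := hG.b_ne_zero_iff.1 (show b (col x) i ≠ 0 by rwa [hx])
      obtain ⟨y', hy'⟩ := hH.b_ne_zero_iff.1 (show b' (col' x') i ≠ 0 by rwa [hx', ← hbi])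
      have hc : c t (i + 1) = c' t (i + 1) := by
        refine eq_of_walkCount_eq ih (fun j hj => ?_) (fun j hj => ?_) (hwalk (2 * i + 1))
        · rw [← hx]
          exact hG.b_ne_zero_iff.2 (hG.exists_dist_eq (y := y) (by omega))
        · obtain ⟨z, hz⟩ := hG.exists_dist_eq (x := x) (y := y) (j := j + 1) (by omega)
          rw [← hx]
          exact hG.c_ne_zero hz
      refine ⟨hc, ?_⟩
      have h1 := hG.c_add_b x y
      have h2 := hH.c_add_b x' y'
      rw [hG.col_eq x y, hy, hx] at h1
      rw [hH.col_eq x' y', hy', hx'] at h2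
      rw [hc, hval, ← h2] at h1
      exact Nat.add_left_cancel h1

theorem HasArrays.cEquiv_of_cospectral (hG : G.HasArrays col c b)
    (hH : H.HasArrays col' c' b') (h : G.Cospectral H) : CEquiv 3 G H := by
  obtain ⟨x⟩ := hG.connected.nonempty
  obtain ⟨x'⟩ := hH.connected.nonempty
  have hcard := h.card_eq
  -- With one vertex a class is empty and its array unconstrained, so zero arrays are used instead.
  rcases subsingleton_or_nontrivial V with hV | hV
  · have hW : Subsingleton W := by
      rw [← Fintype.card_le_one_iff_subsingleton] at hV ⊢
      omega
    exact (hasArrays_of_subsingleton hG.connected).cEquiv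
      (hasArrays_of_subsingleton hH.connected) (x := x) (x' := x') rfl
  · have hW : Nontrivial W := by
      rw [← Fintype.one_lt_card_iff_nontrivial] at hV ⊢
      omega
    rcases hG.valency_eq_or hH h with hval | hval
    · obtain ⟨rfl, rfl⟩ := hG.eq_of_valency_eq hH h hval
      obtain ⟨y, hy⟩ := hH.exists_col (col x)
      exact hG.cEquiv hH hy.symm
    · obtain ⟨rfl, rfl⟩ := hG.eq_of_valency_eq hH.flip h hval
      obtain ⟨y, hy⟩ := hH.flip.exists_col (col x)
      exact hG.cEquiv hH.flip hy.symm

end Cospectral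

end SimpleGraph

theorem theorem4p6 {V W : Type*} [Fintype V] [Fintype W]
    (Γ : SimpleGraph V) (Δ : SimpleGraph W)
    (hΓ : Γ.IsDistanceBiregular) (hΔ : Δ.IsDistanceBiregular) :
    Γ.Cospectral Δ ↔ SimpleGraph.CEquiv 3 Γ Δ := by
  have := hΓ.1.1.nonempty
  have := hΔ.1.1.nonempty
  constructor
  · obtain ⟨_, _, _, hG⟩ := hΓ.exists_hasArrays
    obtain ⟨_, _, _, hH⟩ := hΔ.exists_hasArrays
    exact hG.cEquiv_of_cospectral hH
  · exact fun h => SimpleGraph.cospectral_iff_trace_adjMatrix_pow.2 h.trace_adjMatrix_pow
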